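/- Let $n\ge 3$, let $J\subseteq\mathbb R$ be a nonempty open interval and $r:J\to(0,\infty)$ a smooth function, let $e\in\mathbb R^{n+1}$ be a unit vector, $c\in\mathbb R^{n+1}$ and $x_0(t)=c+te$. Let $M\subset\mathbb R^{n+1}$ be the rotational hypersurface $$M=\{x : \text{for some } t\in J,\ |x-x_0(t)|^2=r(t)^2 \text{ and } \langle e,x-x_0(t)\rangle=0\},$$ with the induced Riemannian metric $g$, Levi-Civita connection $\nabla$ and curvature tensor $R(X,Y,Z,U)=g(R(X,Y)Z,U)$, $R(X,Y)=[\nabla_X,\nabla_Y]-\nabla_{[X,Y]}$. Define functions of $t\in J$ by $$a=\frac{1}{r^2(1+r'^2)},\qquad b=-\frac{1+r'^2+rr''}{r^2(1+r'^2)^2}.$$ A Riemannian manifold $(M,g)$ is called *directed* by a smooth 1-form $\eta$ of pointwise norm $1$, with $\Delta=\ker\eta$, if for every point $p$ and every 2-plane $E\subset T_pM$ with orthonormal basis $X,Y$ the sectional 1-form $\varphi_E(Z)=(\nabla_ZR)(X,Y,Y,X)$, $Z\in E$, satisfies $\varphi_E=k(E,p)\,\eta|_E$ for some number $k(E,p)$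 when $E\not\subset\Delta$, and $\varphi_E=0$ when $E\subset\Delta$. It is *of pointwise constant relative sectional curvature* if it is directed by some such $\eta$ for which $k(E,p)$ is, at each point $p$, the same for all 2-planes $E\not\subset\Delta$ at $p$. Then $(M,g)$ has curvature tensor $R=a\pi+b\Phi$, where $a,b$ are evaluated at the parameter $t$ of the point, $$\pi(X,Y,Z,U)=g(Y,Z)g(X,U)-g(X,Z)g(Y,U),$$ $$\Phi(X,Y,Z,U)=g(Y,Z)\eta(X)\eta(U)-g(X,Z)\eta(Y)\eta(U)+g(X,U)\eta(Y)\eta(Z)-g(Y,U)\eta(X)\eta(Z),$$ and here $\eta=g(\xi,\cdot)$ for a unit tangent vector $\xi$ perpendicular to the parallel (the $(n-1)$-sphere of the family) through the point. Moreover, $(M,g)$ is of pointwise constant relative sectional curvature if and only if $a-b$ is constant on $J$. -/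

import Mathlib

open scoped Manifold ContDiff RealInnerProductSpace

noncomputable section

/-! ### Riemannian geometry in a chart

`G : E → E →L[ℝ] E →L[ℝ] ℝ` is the expression of a metric in a chart with values in the model
space `E`; vectors of `E` play the role of constant vector fields. -/

section Local

variable {E : Type*} [NormedAddCommGroup E] [NormedSpace ℝ E]

/-- Christoffel symbols of the second kind at `y`: the vector `Γ(u, v)` with
`G(Γ(u, v), w) = ½ (D_u G(v, w) + D_v G(u, w) - D_w G(u, v))` for all `w`.
The Levi-Civita connection in the chart is `∇_u W = D_u W + Γ(u, W)`. -/
def christoffel (G : E → E →L[ℝ] E →L[ℝ] ℝ) (y u v : E) : E :=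
  (G y).inverse ((1 / 2 : ℝ) •
    (fderiv ℝ G y u v + fderiv ℝ G y v u - ((fderiv ℝ G y).flip u).flip v))

/-- The curvature operator `R(u, v) w = ∇_u ∇_v w - ∇_v ∇_u w` on constant fields `u, v, w`. -/
def localCurvatureOp (G : E → E →L[ℝ] E →L[ℝ] ℝ) (y u v w : E) : E :=
  fderiv ℝ (fun x => christoffel G x v w) y u - fderiv ℝ (fun x => christoffel G x u w) y v
    + christoffel G y u (christoffel G y v w) - christoffel G y v (christoffel G y u w)

/-- The `(0,4)` curvature tensor `R(u, v, w, z) = G(R(u, v) w, z)`. -/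
def localCurvature (G : E → E →L[ℝ] E →L[ℝ] ℝ) (y u v w z : E) : ℝ :=
  G y (localCurvatureOp G y u v w) z

/-- The covariant derivative `(∇_s R)(u, v, w, z)` of the `(0,4)` curvature tensor. -/
def localCovDerivCurvature (G : E → E →L[ℝ] E →L[ℝ] ℝ) (y s u v w z : E) : ℝ :=
  fderiv ℝ (fun x => localCurvature G x u v w z) y s
    - localCurvature G y (christoffel G y s u) v w z
    - localCurvature G y u (christoffel G y s v) w z
    - localCurvature G y u v (christoffel G y s w) z
    - localCurvature G y u v w (christoffel G y s z)

end Local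

/-! ### Riemannian manifolds -/

section Global

variable {E : Type*} [NormedAddCommGroup E] [NormedSpace ℝ E]
  {H : Type*} [TopologicalSpace H] {I : ModelWithCorners ℝ E H}
  {M : Type*} [TopologicalSpace M] [ChartedSpace H M] [IsManifold I ∞ M]

/-- The metric `g` read in the chart `φ` around `p`: at `y` it is the pullback of `g` at
`φ⁻¹ y` by the derivative of `φ⁻¹` at `y`. -/
def metricInChart (g : Bundle.ContMDiffRiemannianMetric I ∞ E (fun x : M => TangentSpace I x))
    (p : M) (y : E) : E →L[ℝ] E →L[ℝ] ℝ :=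
  let T : E →L[ℝ] TangentSpace I ((extChartAt I p).symm y) :=
    mfderiv 𝓘(ℝ, E) I (extChartAt I p).symm y
  (ContinuousLinearMap.precomp ℝ T) ∘L (g.inner ((extChartAt I p).symm y)) ∘L T

/-- The components in the chart `φ` around `p` of a tangent vector at `p`, i.e. `dφ_p X`. -/
def inChart (p : M) (X : TangentSpace I p) : E :=
  (mfderiv I 𝓘(ℝ, E) (extChartAt I p) p : TangentSpace I p →L[ℝ] E) X

/-- The `(0,4)` curvature tensor `R(X, Y, Z, U) = g(R(X, Y) Z, U)` at `p`, where
`R(X, Y) = [∇_X, ∇_Y] - ∇_[X, Y]` for the Levi-Civita connection `∇`. -/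
def curvatureTensor
    (g : Bundle.ContMDiffRiemannianMetric I ∞ E (fun x : M => TangentSpace I x))
    (p : M) (X Y Z U : TangentSpace I p) : ℝ :=
  localCurvature (metricInChart g p) (extChartAt I p p)
    (inChart p X) (inChart p Y) (inChart p Z) (inChart p U)

/-- The covariant derivative `(∇_W R)(X, Y, Z, U)` at `p` of the curvature tensor. -/
def covDerivCurvature
    (g : Bundle.ContMDiffRiemannianMetric I ∞ E (fun x : M => TangentSpace I x))
    (p : M) (W X Y Z U : TangentSpace I p) : ℝ :=
  localCovDerivCurvature (metricInChart g p) (extChartAt I p p)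
    (inChart p W) (inChart p X) (inChart p Y) (inChart p Z) (inChart p U)

/-- The tensor `π(X, Y, Z, U) = g(Y, Z) g(X, U) - g(X, Z) g(Y, U)`. -/
def piTensor (g : Bundle.ContMDiffRiemannianMetric I ∞ E (fun x : M => TangentSpace I x))
    (p : M) (X Y Z U : TangentSpace I p) : ℝ :=
  g.inner p Y Z * g.inner p X U - g.inner p X Z * g.inner p Y U

/-- The tensor `Φ(X, Y, Z, U) = g(Y, Z) η(X) η(U) - g(X, Z) η(Y) η(U) + g(X, U) η(Y) η(Z)
- g(Y, U) η(X) η(Z)` at `p`, for the covector `η`. -/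
def phiTensor (g : Bundle.ContMDiffRiemannianMetric I ∞ E (fun x : M => TangentSpace I x))
    (p : M) (η : TangentSpace I p →L[ℝ] ℝ) (X Y Z U : TangentSpace I p) : ℝ :=
  g.inner p Y Z * η X * η U - g.inner p X Z * η Y * η U
    + g.inner p X U * η Y * η Z - g.inner p Y U * η X * η Z

/-- A smooth 1-form of pointwise `g`-norm one: at each point it is the `g`-dual of a unit
vector. -/
structure IsUnitOneForm
    (g : Bundle.ContMDiffRiemannianMetric I ∞ E (fun x : M => TangentSpace I x))
    (η : ∀ p : M, TangentSpace I p →L[ℝ] ℝ) : Prop where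
  smooth : ContMDiff I (I.prod 𝓘(ℝ, E →L[ℝ] ℝ)) ∞
    (fun p => Bundle.TotalSpace.mk' (E →L[ℝ] ℝ)
      (E := fun x : M => TangentSpace I x →L[ℝ] Bundle.Trivial M ℝ x) p (η p))
  unit : ∀ p, ∃ ξ : TangentSpace I p, g.inner p ξ ξ = 1 ∧ ∀ X, η p X = g.inner p ξ X

/-- `(X, Y)` is a `g`-orthonormal basis of the 2-plane `P` of the tangent space at `p`. -/
structure IsOrthonormalBasisOf
    (g : Bundle.ContMDiffRiemannianMetric I ∞ E (fun x : M => TangentSpace I x))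
    (p : M) (P : Submodule ℝ (TangentSpace I p)) (X Y : TangentSpace I p) : Prop where
  norm_left : g.inner p X X = 1
  norm_right : g.inner p Y Y = 1
  orthogonal : g.inner p X Y = 0
  span_eq : Submodule.span ℝ {X, Y} = P

/-- The sectional 1-form `φ_P(Z) = (∇_Z R)(X, Y, Y, X)` of the plane `P` with orthonormal basis
`(X, Y)`; it is used for `Z ∈ P`. -/
def sectionalForm (g : Bundle.ContMDiffRiemannianMetric I ∞ E (fun x : M => TangentSpace I x))
    (p : M) (X Y Z : TangentSpace I p) : ℝ :=
  covDerivCurvature g p Z X Y Y X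

/-- `(M, g)` is directed by `η` with relative sectional curvature `k`: for each 2-plane `P` of
`T_p M`, one has `φ_P = k(p, P) η|_P` if `P ⊄ Δ(p) = ker η_p`, and `φ_P = 0` if `P ⊆ Δ(p)`.
(Only the values of `k` on the 2-planes `P ⊄ Δ(p)` matter.) -/
def IsRelativeSectionalCurvature
    (g : Bundle.ContMDiffRiemannianMetric I ∞ E (fun x : M => TangentSpace I x))
    (η : ∀ p : M, TangentSpace I p →L[ℝ] ℝ)
    (k : ∀ p : M, Submodule ℝ (TangentSpace I p) → ℝ) : Prop :=
  ∀ (p : M) (P : Submodule ℝ (TangentSpace I p)) (X Y : TangentSpace I p),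
    IsOrthonormalBasisOf g p P X Y →
      ((¬ ∀ Z ∈ P, η p Z = 0) → ∀ Z ∈ P, sectionalForm g p X Y Z = k p P * η p Z) ∧
      ((∀ Z ∈ P, η p Z = 0) → ∀ Z ∈ P, sectionalForm g p X Y Z = 0)

/-- `(M, g)` is a directed Riemannian manifold of pointwise constant relative sectional
curvature: it is directed by some unit 1-form `η`, and at each point `p` the relative sectional
curvature `k(p, P)` is the same for all 2-planes `P ⊄ Δ(p)`. -/
def HasPointwiseConstantRelativeSectionalCurvature
    (g : Bundle.ContMDiffRiemannianMetric I ∞ E (fun x : M => TangentSpace I x)) : Prop :=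
  ∃ η : ∀ p : M, TangentSpace I p →L[ℝ] ℝ, IsUnitOneForm g η ∧
    ∃ k : ∀ p : M, Submodule ℝ (TangentSpace I p) → ℝ, IsRelativeSectionalCurvature g η k ∧
      ∀ (p : M) (P Q : Submodule ℝ (TangentSpace I p)),
        Module.finrank ℝ P = 2 → Module.finrank ℝ Q = 2 →
        (¬ ∀ Z ∈ P, η p Z = 0) → (¬ ∀ Z ∈ Q, η p Z = 0) → k p P = k p Q

/-! ### Rotational hypersurfaces -/

/-- The image `df_p X` in the ambient Euclidean space of a tangent vector `X` at `p`. -/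
def ambientVector {n : ℕ} (f : M → EuclideanSpace ℝ (Fin (n + 1))) (p : M)
    (X : TangentSpace I p) : EuclideanSpace ℝ (Fin (n + 1)) :=
  (mfderiv I 𝓘(ℝ, EuclideanSpace ℝ (Fin (n + 1))) f p :
    TangentSpace I p →L[ℝ] EuclideanSpace ℝ (Fin (n + 1))) X

/-- `f` realizes the `n`-dimensional Riemannian manifold `(M, g)` as the rotational hypersurface of
`ℝⁿ⁺¹` that is the union over `t` in the open interval `J` of the `(n-1)`-spheres
`(x - x₀(t))² = r(t)²`, `⟨e, x - x₀(t)⟩ = 0`, with centres `x₀(t) = c + t e` on the axis through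
`c` with unit direction `e`: `f` is a smooth topological embedding onto this hypersurface and `g`
is the metric induced by `f` (so `f` is an immersion, `g` being positive definite). -/
structure IsRotationalHypersurface (n : ℕ)
    (g : Bundle.ContMDiffRiemannianMetric I ∞ E (fun x : M => TangentSpace I x))
    (f : M → EuclideanSpace ℝ (Fin (n + 1))) (c e : EuclideanSpace ℝ (Fin (n + 1)))
    (J : Set ℝ) (r : ℝ → ℝ) : Prop where
  finrank_eq : Module.finrank ℝ E = n
  isOpen : IsOpen J
  ordConnected : J.OrdConnected
  nonempty : J.Nonempty
  norm_axis : ‖e‖ = 1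
  radius_smooth : ContDiffOn ℝ ∞ r J
  radius_pos : ∀ t ∈ J, 0 < r t
  smooth : ContMDiff I 𝓘(ℝ, EuclideanSpace ℝ (Fin (n + 1))) ∞ f
  isEmbedding : Topology.IsEmbedding f
  range_eq : Set.range f =
    {x | ∃ t ∈ J, ‖x - (c + t • e)‖ ^ 2 = r t ^ 2 ∧ ⟪e, x - (c + t • e)⟫ = 0}
  induced : ∀ (p : M) (X Y : TangentSpace I p),
    g.inner p X Y = ⟪ambientVector f p X, ambientVector f p Y⟫

/-- The parameter `t` of the parallel through the point `x`, for the axis through `c` with unit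
direction `e`. -/
def axialParameter {n : ℕ} (c e x : EuclideanSpace ℝ (Fin (n + 1))) : ℝ := ⟪e, x - c⟫

/-- `ξ` is a unit tangent vector at `p` perpendicular to the parallel through `p`; the tangent
vectors of this parallel are the `X` with `⟨e, df(X)⟩ = 0`. Such a `ξ` is unique up to sign. -/
structure IsMeridianUnitVector {n : ℕ}
    (g : Bundle.ContMDiffRiemannianMetric I ∞ E (fun x : M => TangentSpace I x))
    (f : M → EuclideanSpace ℝ (Fin (n + 1))) (e : EuclideanSpace ℝ (Fin (n + 1)))
    (p : M) (ξ : TangentSpace I p) : Prop where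
  unit : g.inner p ξ ξ = 1
  perp : ∀ X : TangentSpace I p, ⟪e, ambientVector f p X⟫ = 0 → g.inner p ξ X = 0

/-- The function `a = 1 / (r² (1 + r'²))`. -/
def coeffA (r : ℝ → ℝ) (t : ℝ) : ℝ := 1 / (r t ^ 2 * (1 + deriv r t ^ 2))

/-- The function `b = -(1 + r'² + r r'') / (r² (1 + r'²)²)`. -/
def coeffB (r : ℝ → ℝ) (t : ℝ) : ℝ :=
  -((1 + deriv r t ^ 2 + r t * deriv (deriv r) t) / (r t ^ 2 * (1 + deriv r t ^ 2) ^ 2))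

end Global

end

/-! ### Gauss formula and Gauss equation for an immersion, in coordinates. -/

section Immersion

variable {E : Type*} [NormedAddCommGroup E] [NormedSpace ℝ E]
  {V : Type*} [NormedAddCommGroup V] [InnerProductSpace ℝ V]
  {V' : Type*} [NormedAddCommGroup V'] [NormedSpace ℝ V']

/-! In a chart, M is an immersion F with |F - c|² = t² + r(t)², where t = ⟨e, F - c⟩. Write τ = dt.
Differentiating this relation once shows that ν = F - c - (t + r r')e is normal; it satisfies |ν|² =
r²(1 + r'²) = 1/a. Differentiating again gives ⟨ν, D²F(u, v)⟩ = -h(u, v) with h = G - q τ⊗τ and q =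
1 + r'² + r r''. Hence the second fundamental form is -a h ν (`secondFundamentalForm_eq`). In the
Gauss equation the terms of fourth order in τ cancel, so R = aπ - aq Φ_τ, where Φ_τ is Φ with τ in
place of η. Since η = ±√(1 + r'²) τ, this is aπ + bΦ.

The Hessian of t is ∇τ = ⟨e, -a h ν⟩ = a r r' h, and G is parallel, so ∇R is explicit
(`localCovDerivCurvature_eq`). On a plane with orthonormal basis X, Y it gives (`sectionalForm_eq`)
φ(Z) = (S(t) - (1 + r'²)(a - b)'(τ(X)² + τ(Y)²)) τ(Z), with S depending on t only. If (a - b)' = 0,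
then M is directed by √(1 + r'²) τ with a factor independent of the plane.

Conversely, at each point the definition forces φ = K η with one number K for all planes, whatever
the directing form η. Comparing a plane tangent to the parallel, a plane containing the meridian
direction and a plane inclined at 45° isolates (a - b)' and makes it vanish. Here n ≥ 3 supplies two
orthonormal directions in the parallel. Connectedness of J then makes a - b constant. -/

theorem contDiffAt_fderiv_apply {f : E → V'} {x : E}
    (hf : ContDiffAt ℝ ∞ f x) (s : E) : ContDiffAt ℝ 1 (fun x => fderiv ℝ f x s) x :=
  (hf.fderiv_right (m := 1) (by norm_cast)).clm_apply contDiffAt_const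

/-- On the open set `U`, `G` is the metric induced by the smooth immersion `F`. -/
structure IsInducedMetric (G : E → E →L[ℝ] E →L[ℝ] ℝ) (F : E → V) (U : Set E) : Prop where
  isOpen : IsOpen U
  smooth : ContDiffOn ℝ ∞ F U
  metric : ∀ y ∈ U, ∀ u v, G y u v = ⟪fderiv ℝ F y u, fderiv ℝ F y v⟫
  injective : ∀ y ∈ U, Function.Injective (fderiv ℝ F y)

namespace IsInducedMetric

variable {G : E → E →L[ℝ] E →L[ℝ] ℝ} {F : E → V} {U : Set E} {y : E}

theorem contDiffAt (h : IsInducedMetric G F U) (hy : y ∈ U) : ContDiffAt ℝ ∞ F y :=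
  h.smooth.contDiffAt (h.isOpen.mem_nhds hy)

theorem contDiffAt_fderiv (h : IsInducedMetric G F U) (hy : y ∈ U) :
    ContDiffAt ℝ ∞ (fderiv ℝ F) y :=
  (h.contDiffAt hy).fderiv_right (by simp)

theorem contDiffAt_fderiv_fderiv (h : IsInducedMetric G F U) (hy : y ∈ U) :
    ContDiffAt ℝ ∞ (fderiv ℝ (fderiv ℝ F)) y :=
  (h.contDiffAt_fderiv hy).fderiv_right (by simp)

theorem hasFDerivAt_fderiv_apply (h : IsInducedMetric G F U) (hy : y ∈ U) (v : E) :
    HasFDerivAt (fun x => fderiv ℝ F x v) ((fderiv ℝ (fderiv ℝ F) y).flip v) y := by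
  have h1 := ((h.contDiffAt_fderiv hy).differentiableAt (by simp)).hasFDerivAt
  exact (h1.clm_apply (hasFDerivAt_const v y)).congr_fderiv (by ext; simp)

theorem hasFDerivAt_fderiv_fderiv_apply (h : IsInducedMetric G F U) (hy : y ∈ U) (v w : E) :
    HasFDerivAt (fun x => fderiv ℝ (fderiv ℝ F) x v w)
      (((fderiv ℝ (fderiv ℝ (fderiv ℝ F)) y).flip v).flip w) y := by
  have h1 := ((h.contDiffAt_fderiv_fderiv hy).differentiableAt (by simp)).hasFDerivAt
  exact ((h1.clm_apply (hasFDerivAt_const v y)).clm_apply (hasFDerivAt_const w y)).congr_fderiv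
    (by ext; simp)

theorem fderiv_fderiv_comm (h : IsInducedMetric G F U) (hy : y ∈ U) (u v : E) :
    fderiv ℝ (fderiv ℝ F) y u v = fderiv ℝ (fderiv ℝ F) y v u :=
  (h.contDiffAt hy).isSymmSndFDerivAt (by simpa using ENat.LEInfty.out) u v

theorem fderiv_fderiv_fderiv_comm (h : IsInducedMetric G F U) (hy : y ∈ U) (u v w : E) :
    fderiv ℝ (fderiv ℝ (fderiv ℝ F)) y u v w = fderiv ℝ (fderiv ℝ (fderiv ℝ F)) y v u w := by
  rw [(h.contDiffAt_fderiv hy).isSymmSndFDerivAt (by simpa using ENat.LEInfty.out) u v]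

theorem eventually_mem (h : IsInducedMetric G F U) (hy : y ∈ U) : ∀ᶠ x in nhds y, x ∈ U :=
  h.isOpen.mem_nhds hy

theorem contDiffAt_metric [FiniteDimensional ℝ E] (h : IsInducedMetric G F U) (hy : y ∈ U) :
    ContDiffAt ℝ ∞ G y := by
  refine ContDiffOn.contDiffAt (s := U) ?_ (h.isOpen.mem_nhds hy)
  refine contDiffOn_clm_apply.2 fun u => contDiffOn_clm_apply.2 fun v => ?_
  refine ContDiffOn.congr (f := fun x => ⟪fderiv ℝ F x u, fderiv ℝ F x v⟫) (fun x hx => ?_)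
    fun x hx => h.metric x hx u v
  exact (((h.contDiffAt_fderiv hx).clm_apply contDiffAt_const).inner ℝ
    ((h.contDiffAt_fderiv hx).clm_apply contDiffAt_const)).contDiffWithinAt

theorem hasFDerivAt_metric_apply [FiniteDimensional ℝ E] (h : IsInducedMetric G F U) (hy : y ∈ U)
    (u v : E) : HasFDerivAt (fun x => G x u v) (((fderiv ℝ G y).flip u).flip v) y := by
  have h1 := ((h.contDiffAt_metric hy).differentiableAt (by simp)).hasFDerivAt
  exact ((h1.clm_apply (hasFDerivAt_const u y)).clm_apply (hasFDerivAt_const v y)).congr_fderiv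
    (by ext; simp)

theorem fderiv_metric_apply [FiniteDimensional ℝ E] (h : IsInducedMetric G F U) (hy : y ∈ U)
    (s u v : E) : fderiv ℝ G y s u v =
      ⟪fderiv ℝ (fderiv ℝ F) y s u, fderiv ℝ F y v⟫
        + ⟪fderiv ℝ F y u, fderiv ℝ (fderiv ℝ F) y s v⟫ := by
  have h1 : (fun x => G x u v) =ᶠ[nhds y] fun x => ⟪fderiv ℝ F x u, fderiv ℝ F x v⟫ :=
    (h.eventually_mem hy).mono fun x hx => h.metric x hx u v
  have h2 := ((h.hasFDerivAt_fderiv_apply hy u).inner ℝ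
    (h.hasFDerivAt_fderiv_apply hy v)).congr_of_eventuallyEq h1
  have h3 := congrArg (fun L => L s) ((h.hasFDerivAt_metric_apply hy u v).unique h2)
  simp at h3
  rw [h3]; ring

/-- `christoffel` uses `ContinuousLinearMap.inverse`, which is meaningful only at invertible maps.
Positive definiteness gives injectivity, and E and its dual have equal dimension. -/
theorem isInvertible [FiniteDimensional ℝ E] (h : IsInducedMetric G F U) (hy : y ∈ U) :
    (G y).IsInvertible := by
  have hinj : Function.Injective (G y : E →ₗ[ℝ] E →L[ℝ] ℝ) := by
    refine (injective_iff_map_eq_zero _).2 fun u hu => ?_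
    have : G y u u = 0 := by
      have := congrArg (fun L : E →L[ℝ] ℝ => L u) hu
      simpa using this
    rw [h.metric y hy, inner_self_eq_zero] at this
    exact (injective_iff_map_eq_zero _).1 (h.injective y hy) u this
  have hfr : Module.finrank ℝ E = Module.finrank ℝ (E →L[ℝ] ℝ) := by
    rw [← (LinearMap.toContinuousLinearMap : (E →ₗ[ℝ] ℝ) ≃ₗ[ℝ] (E →L[ℝ] ℝ)).finrank_eq]
    exact Subspace.dual_finrank_eq.symm
  exact ⟨(LinearEquiv.ofInjectiveOfFinrankEq (G y : E →ₗ[ℝ] E →L[ℝ] ℝ) hinj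
    hfr).toContinuousLinearEquiv, by ext; rfl⟩

/-- In the Koszul expression the product rule gives six terms; by symmetry of D²F four cancel and
the other two agree. Thus dF(Γ(u, v)) is the tangential part of D²F(u, v). -/
theorem metric_christoffel [FiniteDimensional ℝ E] (h : IsInducedMetric G F U) (hy : y ∈ U)
    (u v w : E) : G y (christoffel G y u v) w =
      ⟪fderiv ℝ (fderiv ℝ F) y u v, fderiv ℝ F y w⟫ := by
  rw [christoffel, (h.isInvertible hy).self_apply_inverse]
  simp only [smul_apply, add_apply,
    sub_apply, ContinuousLinearMap.flip_apply, h.fderiv_metric_apply hy,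
    smul_eq_mul]
  rw [h.fderiv_fderiv_comm hy v u, h.fderiv_fderiv_comm hy w u, h.fderiv_fderiv_comm hy w v,
    real_inner_comm _ (fderiv ℝ F y v), real_inner_comm _ (fderiv ℝ F y u)]
  ring

theorem inner_fderiv_christoffel [FiniteDimensional ℝ E] (h : IsInducedMetric G F U) (hy : y ∈ U)
    (u v w : E) : ⟪fderiv ℝ F y (christoffel G y u v), fderiv ℝ F y w⟫ =
      ⟪fderiv ℝ (fderiv ℝ F) y u v, fderiv ℝ F y w⟫ := by
  rw [← h.metric y hy, h.metric_christoffel hy]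

/-- Metric compatibility, ∇G = 0; it removes the derivatives of G from ∇R later. -/
theorem fderiv_metric_eq_christoffel [FiniteDimensional ℝ E] (h : IsInducedMetric G F U)
    (hy : y ∈ U) (s u v : E) : fderiv ℝ G y s u v =
      G y (christoffel G y s u) v + G y u (christoffel G y s v) := by
  rw [h.fderiv_metric_apply hy, h.metric_christoffel hy, h.metric y hy u,
    real_inner_comm _ (fderiv ℝ F y u), ← h.inner_fderiv_christoffel hy s v,
    real_inner_comm (fderiv ℝ F y u)]

theorem differentiableAt_christoffel [FiniteDimensional ℝ E] (h : IsInducedMetric G F U)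
    (hy : y ∈ U) (u v : E) : DifferentiableAt ℝ (fun x => christoffel G x u v) y := by
  have : CompleteSpace E := FiniteDimensional.complete ℝ E
  obtain ⟨A, hA⟩ := h.isInvertible hy
  have h1 : ContDiffAt ℝ 1 (ContinuousLinearMap.inverse (R := ℝ) (M := E) (M₂ := E →L[ℝ] ℝ))
      (G y) := hA ▸ contDiffAt_map_inverse A
  have h2 : DifferentiableAt ℝ (fun x => (G x).inverse) y :=
    (h1.differentiableAt (by simp)).comp y ((h.contDiffAt_metric hy).differentiableAt (by simp))
  have h3 (s u v : E) : ContDiffOn ℝ 1 (fun x => fderiv ℝ G x s u v) U := fun x hx => by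
    exact (((contDiffAt_fderiv_apply (h.contDiffAt_metric hx) s).clm_apply
      contDiffAt_const).clm_apply contDiffAt_const).contDiffWithinAt
  have h5 : ContDiffOn ℝ 1 (fun x => (1 / 2 : ℝ) •
      (fderiv ℝ G x u v + fderiv ℝ G x v u - ((fderiv ℝ G x).flip u).flip v)) U :=
    -- In the flipped term w is the direction of differentiation. In finite dimension it suffices to
    -- check smoothness after evaluation at each w.
    contDiffOn_clm_apply.2 fun w =>
      (((h3 u v w).add (h3 v u w)).sub (h3 w u v)).const_smul (1 / 2 : ℝ)
  exact h2.clm_apply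
    ((h5.contDiffAt (h.isOpen.mem_nhds hy)).differentiableAt (by simp))

/-- The vector-valued second fundamental form of the immersion `F`. -/
noncomputable def _root_.secondFundamentalForm (G : E → E →L[ℝ] E →L[ℝ] ℝ) (F : E → V)
    (y u v : E) : V :=
  fderiv ℝ (fderiv ℝ F) y u v - fderiv ℝ F y (christoffel G y u v)

theorem inner_secondFundamentalForm [FiniteDimensional ℝ E] (h : IsInducedMetric G F U)
    (hy : y ∈ U) (u v w : E) : ⟪secondFundamentalForm G F y u v, fderiv ℝ F y w⟫ = 0 := by
  rw [secondFundamentalForm, inner_sub_left, h.inner_fderiv_christoffel hy, sub_self]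

/-- Half of the curvature, obtained by differentiating `metric_christoffel` in direction u. The
third derivative of F is symmetric in u and v, so it disappears on antisymmetrizing. -/
theorem metric_fderiv_christoffel [FiniteDimensional ℝ E] (h : IsInducedMetric G F U)
    (hy : y ∈ U) (u v w z : E) :
    G y (fderiv ℝ (fun x => christoffel G x v w) y u + christoffel G y u (christoffel G y v w)) z =
      ⟪fderiv ℝ (fderiv ℝ (fderiv ℝ F)) y u v w, fderiv ℝ F y z⟫
        + ⟪secondFundamentalForm G F y v w, fderiv ℝ (fderiv ℝ F) y u z⟫ := by
  have h1 : (fun x => G x (christoffel G x v w) z) =ᶠ[nhds y]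
      fun x => ⟪fderiv ℝ (fderiv ℝ F) x v w, fderiv ℝ F x z⟫ :=
    (h.eventually_mem hy).mono fun x hx => h.metric_christoffel hx v w z
  have h2 := ((h.hasFDerivAt_fderiv_fderiv_apply hy v w).inner ℝ
    (h.hasFDerivAt_fderiv_apply hy z)).congr_of_eventuallyEq h1
  have h3 := ((((h.contDiffAt_metric hy).differentiableAt (by simp)).hasFDerivAt).clm_apply
    (h.differentiableAt_christoffel hy v w).hasFDerivAt).clm_apply (hasFDerivAt_const z y)
  have h4 := congrArg (fun L => L u) (h3.unique h2)
  simp at h4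
  rw [h.fderiv_metric_apply hy, ← h.metric_christoffel hy] at h4
  rw [map_add, add_apply, secondFundamentalForm, inner_sub_left]
  linarith

/-- The Gauss equation. -/
theorem localCurvature_eq [FiniteDimensional ℝ E] (h : IsInducedMetric G F U)
    (hy : y ∈ U) (u v w z : E) : localCurvature G y u v w z =
      ⟪secondFundamentalForm G F y v w, fderiv ℝ (fderiv ℝ F) y u z⟫
        - ⟪secondFundamentalForm G F y u w, fderiv ℝ (fderiv ℝ F) y v z⟫ := by
  have h1 := h.metric_fderiv_christoffel hy u v w z
  have h2 := h.metric_fderiv_christoffel hy v u w z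
  rw [h.fderiv_fderiv_fderiv_comm hy v u] at h2
  rw [localCurvature, localCurvatureOp]
  simp only [map_add, map_sub, add_apply, sub_apply]
    at h1 h2 ⊢
  linarith

end IsInducedMetric

end Immersion

/-! ### Derivatives of the coefficient functions. -/

section Radius

variable {r : ℝ → ℝ} {J : Set ℝ} {t : ℝ}

theorem contDiffOn_deriv_of_isOpen (hJ : IsOpen J) (hr : ContDiffOn ℝ ∞ r J) :
    ContDiffOn ℝ ∞ (deriv r) J :=
  hr.deriv_of_isOpen hJ (by simp)

theorem ContDiffOn.hasDerivAt_of_isOpen (hr : ContDiffOn ℝ ∞ r J) (hJ : IsOpen J) (ht : t ∈ J) :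
    HasDerivAt r (deriv r t) t :=
  ((hr.contDiffAt (hJ.mem_nhds ht)).differentiableAt (by simp)).hasDerivAt

theorem hasDerivAt_coeffA (hJ : IsOpen J) (hr : ContDiffOn ℝ ∞ r J) (ht : t ∈ J) (h0 : r t ≠ 0) :
    HasDerivAt (coeffA r)
      (-2 * r t * deriv r t * (1 + deriv r t ^ 2 + r t * deriv (deriv r) t) * coeffA r t ^ 2) t := by
  have h1 := hr.hasDerivAt_of_isOpen hJ ht
  have h2 := (contDiffOn_deriv_of_isOpen hJ hr).hasDerivAt_of_isOpen hJ ht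
  have h3 : 1 + deriv r t ^ 2 ≠ 0 := by positivity
  have h4 := (hasDerivAt_const t (1 : ℝ)).fun_div
    ((h1.fun_pow 2).fun_mul ((h2.fun_pow 2).const_add 1)) (by positivity)
  refine h4.congr_deriv ?_
  unfold coeffA
  field_simp
  ring

theorem contDiffOn_coeffB (hJ : IsOpen J) (hr : ContDiffOn ℝ ∞ r J) (h0 : ∀ t ∈ J, r t ≠ 0) :
    ContDiffOn ℝ ∞ (coeffB r) J := by
  have h1 := contDiffOn_deriv_of_isOpen hJ hr
  have h2 := contDiffOn_deriv_of_isOpen hJ h1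
  have h3 (t : ℝ) : 1 + deriv r t ^ 2 ≠ 0 := by positivity
  exact (((contDiffOn_const.add (h1.pow 2)).add (hr.mul h2)).div
    ((hr.pow 2).mul ((contDiffOn_const.add (h1.pow 2)).pow 2))
    fun t ht => mul_ne_zero (pow_ne_zero _ (h0 t ht)) (pow_ne_zero _ (h3 t))).neg

/-- The coefficient of `τ ⊗ g` in the curvature, `τ` being the differential of the axial
parameter. -/
noncomputable def axialCoeff (r : ℝ → ℝ) (t : ℝ) : ℝ := coeffB r t * (1 + deriv r t ^ 2)

theorem axialCoeff_eq (r : ℝ → ℝ) (t : ℝ) : axialCoeff r t =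
    -(coeffA r t * (1 + deriv r t ^ 2 + r t * deriv (deriv r) t)) := by
  have h3 : 1 + deriv r t ^ 2 ≠ 0 := by positivity
  unfold axialCoeff coeffA coeffB
  field_simp

theorem hasDerivAt_axialCoeff (hJ : IsOpen J) (hr : ContDiffOn ℝ ∞ r J) (h0 : ∀ t ∈ J, r t ≠ 0)
    (ht : t ∈ J) : HasDerivAt (axialCoeff r)
      (deriv (coeffB r) t * (1 + deriv r t ^ 2)
        + coeffB r t * (2 * deriv r t * deriv (deriv r) t)) t := by
  have h2 := (contDiffOn_deriv_of_isOpen hJ hr).hasDerivAt_of_isOpen hJ ht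
  have h4 := ((contDiffOn_coeffB hJ hr h0).hasDerivAt_of_isOpen hJ ht).fun_mul
    ((h2.fun_pow 2).const_add 1)
  exact h4.congr_deriv (by ring)

/-- The part of the relative sectional curvature that does not depend on the plane. -/
noncomputable def sectionalConst (r : ℝ → ℝ) (t : ℝ) : ℝ :=
  deriv (coeffA r) t + 2 * axialCoeff r t * (coeffA r t * r t * deriv r t)

/-- The left side is the coefficient of τ(X)² + τ(Y)² in the sectional form. The identity comes down
to a' = 2 b r'/r, and it is what brings a - b into the criterion. -/
theorem deriv_axialCoeff_sub (hJ : IsOpen J) (hr : ContDiffOn ℝ ∞ r J) (h0 : ∀ t ∈ J, r t ≠ 0)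
    (ht : t ∈ J) :
    deriv (axialCoeff r) t - 2 * axialCoeff r t * (coeffA r t * r t * deriv r t)
        * (1 + deriv r t ^ 2 + r t * deriv (deriv r) t) =
      -((1 + deriv r t ^ 2) * deriv (fun s => coeffA r s - coeffB r s) t) := by
  have ha := hasDerivAt_coeffA hJ hr ht (h0 t ht)
  have hb := (contDiffOn_coeffB hJ hr h0).hasDerivAt_of_isOpen hJ ht
  rw [(hasDerivAt_axialCoeff hJ hr h0 ht).deriv, (ha.fun_sub hb).deriv, axialCoeff_eq]
  generalize deriv (coeffB r) t = b'
  have h3 : 1 + deriv r t ^ 2 ≠ 0 := by positivity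
  have h4 := h0 t ht
  unfold coeffA coeffB
  field_simp
  ring

end Radius

/-! ### Curvature and its covariant derivative on a coordinate patch of the hypersurface. -/

section Patch

variable {E : Type*} [NormedAddCommGroup E] [NormedSpace ℝ E]
  {V : Type*} [NormedAddCommGroup V] [InnerProductSpace ℝ V]

/-- `F` parametrizes the open set `U` as a hypersurface which is rotational around the axis through
`c` with direction `e`, of radius `r`, and `G` is the induced metric. -/
structure IsRotationalPatch (G : E → E →L[ℝ] E →L[ℝ] ℝ) (F : E → V) (U : Set E)
    (c e : V) (J : Set ℝ) (r : ℝ → ℝ) : Prop extends IsInducedMetric G F U where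
  finrank_ambient : Module.finrank ℝ V = Module.finrank ℝ E + 1
  isOpen_param : IsOpen J
  norm_axis : ‖e‖ = 1
  radius_smooth : ContDiffOn ℝ ∞ r J
  radius_pos : ∀ t ∈ J, 0 < r t
  mem_param : ∀ y ∈ U, ⟪e, F y - c⟫ ∈ J
  norm_sq : ∀ y ∈ U, ‖F y - c‖ ^ 2 = ⟪e, F y - c⟫ ^ 2 + r ⟪e, F y - c⟫ ^ 2

/-- A normal vector of the rotational hypersurface of radius `r` at the point `x`. -/
noncomputable def rotationalNormal (c e : V) (r : ℝ → ℝ) (x : V) : V :=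
  x - c - (⟪e, x - c⟫ + r ⟪e, x - c⟫ * deriv r ⟪e, x - c⟫) • e

theorem inner_axis_rotationalNormal {c e : V} {r : ℝ → ℝ} (x : V) (he : ‖e‖ = 1) :
    ⟪e, rotationalNormal c e r x⟫ = -(r ⟪e, x - c⟫ * deriv r ⟪e, x - c⟫) := by
  rw [rotationalNormal, inner_sub_right, real_inner_smul_right, real_inner_self_eq_norm_sq, he]
  ring

theorem inner_rotationalNormal_self {c e : V} {r : ℝ → ℝ} {x : V} (he : ‖e‖ = 1)
    (hx : ‖x - c‖ ^ 2 = ⟪e, x - c⟫ ^ 2 + r ⟪e, x - c⟫ ^ 2) :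
    ⟪rotationalNormal c e r x, rotationalNormal c e r x⟫ =
      r ⟪e, x - c⟫ ^ 2 * (1 + deriv r ⟪e, x - c⟫ ^ 2) := by
  conv_lhs => arg 2; rw [rotationalNormal]
  rw [inner_sub_left, real_inner_smul_left, inner_axis_rotationalNormal x he,
    rotationalNormal, inner_sub_right, real_inner_smul_right, real_inner_comm,
    real_inner_self_eq_norm_sq, hx]
  rw [real_inner_comm]
  ring

namespace IsRotationalPatch

variable {G : E → E →L[ℝ] E →L[ℝ] ℝ} {F : E → V} {U : Set E} {c e : V} {J : Set ℝ} {r : ℝ → ℝ}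
  {y : E}

theorem radius_ne_zero (h : IsRotationalPatch G F U c e J r) : ∀ t ∈ J, r t ≠ 0 :=
  fun t ht => (h.radius_pos t ht).ne'

theorem hasFDerivAt (h : IsRotationalPatch G F U c e J r) (hy : y ∈ U) :
    HasFDerivAt (fun x => F x - c) (fderiv ℝ F y) y :=
  ((h.contDiffAt hy).differentiableAt (by simp)).hasFDerivAt.sub_const c

theorem hasFDerivAt_param (h : IsRotationalPatch G F U c e J r) (hy : y ∈ U) :
    HasFDerivAt (fun x => ⟪e, F x - c⟫) (innerSL ℝ e ∘L fderiv ℝ F y) y :=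
  ((innerSL ℝ e).hasFDerivAt).comp y (h.hasFDerivAt hy)

theorem hasFDerivAt_comp_param (h : IsRotationalPatch G F U c e J r) (hy : y ∈ U)
    {φ : ℝ → ℝ} {φ' : ℝ} (hφ : HasDerivAt φ φ' ⟪e, F y - c⟫) :
    HasFDerivAt (fun x => φ ⟪e, F x - c⟫) (φ' • (innerSL ℝ e ∘L fderiv ℝ F y)) y :=
  hφ.comp_hasFDerivAt y (h.hasFDerivAt_param hy)

/-- First derivative of |F - c|² = t² + r(t)²; equivalently, `rotationalNormal` is normal. -/
theorem inner_position (h : IsRotationalPatch G F U c e J r) (hy : y ∈ U) (u : E) :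
    ⟪F y - c, fderiv ℝ F y u⟫ =
      (⟪e, F y - c⟫ + r ⟪e, F y - c⟫ * deriv r ⟪e, F y - c⟫) * ⟪e, fderiv ℝ F y u⟫ := by
  have hr := h.radius_smooth.hasDerivAt_of_isOpen h.isOpen_param (h.mem_param y hy)
  have h1 := h.hasFDerivAt_comp_param hy (((hasDerivAt_id' _).fun_pow 2).fun_add (hr.fun_pow 2))
  have h2 : (fun x => ‖F x - c‖ ^ 2) =ᶠ[nhds y]
      fun x => ⟪e, F x - c⟫ ^ 2 + r ⟪e, F x - c⟫ ^ 2 :=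
    (h.eventually_mem hy).mono fun x hx => h.norm_sq x hx
  have h3 := congrArg (fun L => L u)
    ((h.hasFDerivAt hy).norm_sq.unique (h1.congr_of_eventuallyEq h2))
  simp at h3
  rw [inner_sub_left]
  linarith

theorem inner_rotationalNormal_fderiv (h : IsRotationalPatch G F U c e J r) (hy : y ∈ U) (u : E) :
    ⟪rotationalNormal c e r (F y), fderiv ℝ F y u⟫ = 0 := by
  rw [rotationalNormal, inner_sub_left, real_inner_smul_left, h.inner_position hy, sub_self]

/-- Minus the second fundamental form with respect to the normal `rotationalNormal`. -/
noncomputable def _root_.rotationalForm (G : E → E →L[ℝ] E →L[ℝ] ℝ) (F : E → V)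
    (c e : V) (r : ℝ → ℝ) (y u v : E) : ℝ :=
  G y u v - (1 + deriv r ⟪e, F y - c⟫ ^ 2 + r ⟪e, F y - c⟫ * deriv (deriv r) ⟪e, F y - c⟫)
    * ⟪e, fderiv ℝ F y u⟫ * ⟪e, fderiv ℝ F y v⟫

/-- Differentiate `inner_position` once more. The derivative of t + r r' along u is (1 + r'² + r
r'') τ(u), which produces the correction to G. -/
theorem inner_rotationalNormal_fderiv_fderiv (h : IsRotationalPatch G F U c e J r) (hy : y ∈ U)
    (u v : E) : ⟪rotationalNormal c e r (F y), fderiv ℝ (fderiv ℝ F) y u v⟫ =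
      -rotationalForm G F c e r y u v := by
  have hJ := h.mem_param y hy
  have hr := h.radius_smooth.hasDerivAt_of_isOpen h.isOpen_param hJ
  have hr' := (contDiffOn_deriv_of_isOpen h.isOpen_param h.radius_smooth).hasDerivAt_of_isOpen
    h.isOpen_param hJ
  have h1 := (((h.hasFDerivAt_param hy).fun_add ((h.hasFDerivAt_comp_param hy hr).fun_mul
    (h.hasFDerivAt_comp_param hy hr'))).fun_mul
    ((innerSL ℝ e).hasFDerivAt.comp y (h.hasFDerivAt_fderiv_apply hy v)))
  have h2 : (fun x => ⟪F x - c, fderiv ℝ F x v⟫) =ᶠ[nhds y] _ :=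
    (h.eventually_mem hy).mono fun x hx => h.inner_position hx v
  have h3 := congrArg (fun L => L u) (((h.hasFDerivAt hy).inner ℝ
    (h.hasFDerivAt_fderiv_apply hy v)).unique (h1.congr_of_eventuallyEq h2))
  simp at h3
  rw [rotationalNormal, inner_sub_left, real_inner_smul_left, rotationalForm, h.metric y hy]
  linarith

theorem rotationalNormal_self_ne_zero (h : IsRotationalPatch G F U c e J r) (hy : y ∈ U) :
    r ⟪e, F y - c⟫ ^ 2 * (1 + deriv r ⟪e, F y - c⟫ ^ 2) ≠ 0 := by
  have := h.radius_pos _ (h.mem_param y hy)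
  positivity

/-- The image of dF lies in the orthogonal complement of the nonzero normal and has the same
dimension, because the codimension is one. -/
theorem exists_fderiv_eq [FiniteDimensional ℝ E] [FiniteDimensional ℝ V]
    (h : IsRotationalPatch G F U c e J r) (hy : y ∈ U) {w : V}
    (hw : ⟪rotationalNormal c e r (F y), w⟫ = 0) : ∃ u, fderiv ℝ F y u = w := by
  have h0 : rotationalNormal c e r (F y) ≠ 0 := fun h0 => h.rotationalNormal_self_ne_zero hy (by
    rw [← inner_rotationalNormal_self h.norm_axis (h.norm_sq y hy), h0, inner_zero_left])
  have h1 : LinearMap.range (fderiv ℝ F y : E →ₗ[ℝ] V) ≤ (ℝ ∙ rotationalNormal c e r (F y))ᗮ := by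
    rintro _ ⟨u, rfl⟩
    exact Submodule.mem_orthogonal_singleton_iff_inner_right.2
      (h.inner_rotationalNormal_fderiv hy u)
  have h2 := Submodule.finrank_add_finrank_orthogonal (ℝ ∙ rotationalNormal c e r (F y))
  rw [finrank_span_singleton h0, h.finrank_ambient] at h2
  have h3 := Submodule.eq_of_le_of_finrank_eq h1 (by
    rw [LinearMap.finrank_range_of_inj (h.injective y hy)]; omega)
  have h4 : w ∈ (ℝ ∙ rotationalNormal c e r (F y))ᗮ :=
    Submodule.mem_orthogonal_singleton_iff_inner_right.2 hw
  rw [← h3] at h4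
  exact h4

/-- The difference of the two sides is orthogonal to the normal, hence tangent; it is also
orthogonal to every tangent vector, hence zero. The factor `coeffA` is 1/|ν|². -/
theorem secondFundamentalForm_eq [FiniteDimensional ℝ E] [FiniteDimensional ℝ V]
    (h : IsRotationalPatch G F U c e J r) (hy : y ∈ U) (u v : E) :
    secondFundamentalForm G F y u v =
      (-(coeffA r ⟪e, F y - c⟫ * rotationalForm G F c e r y u v)) •
        rotationalNormal c e r (F y) := by
  have hN := h.rotationalNormal_self_ne_zero hy
  have hs := inner_rotationalNormal_self h.norm_axis (h.norm_sq y hy)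
  have h1 : ⟪rotationalNormal c e r (F y), secondFundamentalForm G F y u v⟫ =
      -rotationalForm G F c e r y u v := by
    rw [secondFundamentalForm, inner_sub_right, h.inner_rotationalNormal_fderiv hy,
      h.inner_rotationalNormal_fderiv_fderiv hy, sub_zero]
  set k := -(coeffA r ⟪e, F y - c⟫ * rotationalForm G F c e r y u v) with hk
  set ν := rotationalNormal c e r (F y)
  have h2 : ⟪ν, secondFundamentalForm G F y u v - k • ν⟫ = 0 := by
    have hr := h.radius_ne_zero _ (h.mem_param y hy)
    have hr' : 1 + deriv r ⟪e, F y - c⟫ ^ 2 ≠ 0 := by positivity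
    rw [inner_sub_right, real_inner_smul_right, h1, hs, hk, coeffA]
    field_simp
    ring
  obtain ⟨w, hw⟩ := h.exists_fderiv_eq hy h2
  have h3 : ⟪secondFundamentalForm G F y u v - k • ν, fderiv ℝ F y w⟫ = 0 := by
    rw [inner_sub_left, real_inner_smul_left, h.inner_secondFundamentalForm hy,
      h.inner_rotationalNormal_fderiv hy]
    simp
  rw [hw, inner_self_eq_zero] at h3
  exact sub_eq_zero.1 h3

theorem localCurvature_eq_axial [FiniteDimensional ℝ E] [FiniteDimensional ℝ V]
    (h : IsRotationalPatch G F U c e J r) (hy : y ∈ U) (u v w z : E) :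
    localCurvature G y u v w z =
      coeffA r ⟪e, F y - c⟫ * (G y v w * G y u z - G y u w * G y v z) +
      axialCoeff r ⟪e, F y - c⟫ *
        (G y v w * (⟪e, fderiv ℝ F y u⟫ * ⟪e, fderiv ℝ F y z⟫)
          - G y u w * (⟪e, fderiv ℝ F y v⟫ * ⟪e, fderiv ℝ F y z⟫)
          + G y u z * (⟪e, fderiv ℝ F y v⟫ * ⟪e, fderiv ℝ F y w⟫)
          - G y v z * (⟪e, fderiv ℝ F y u⟫ * ⟪e, fderiv ℝ F y w⟫)) := by
  rw [h.localCurvature_eq hy, h.secondFundamentalForm_eq hy, h.secondFundamentalForm_eq hy,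
    real_inner_smul_left, real_inner_smul_left, h.inner_rotationalNormal_fderiv_fderiv hy,
    h.inner_rotationalNormal_fderiv_fderiv hy, axialCoeff_eq]
  unfold rotationalForm
  ring

/-- This computes the Hessian ∇τ: pair the Gauss formula with e and use ⟨e, ν⟩ = -r r'. -/
theorem inner_axis_fderiv_fderiv [FiniteDimensional ℝ E] [FiniteDimensional ℝ V]
    (h : IsRotationalPatch G F U c e J r) (hy : y ∈ U) (s u : E) :
    ⟪e, fderiv ℝ (fderiv ℝ F) y s u⟫ = ⟪e, fderiv ℝ F y (christoffel G y s u)⟫ +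
      coeffA r ⟪e, F y - c⟫ * r ⟪e, F y - c⟫ * deriv r ⟪e, F y - c⟫
        * rotationalForm G F c e r y s u := by
  have h1 := congrArg (fun w => ⟪e, w⟫) (h.secondFundamentalForm_eq hy s u)
  simp only [real_inner_smul_right, inner_axis_rotationalNormal _ h.norm_axis] at h1
  rw [secondFundamentalForm, inner_sub_right] at h1
  linarith

/-- Product rule applied to `localCurvature_eq_axial`. As G is parallel, only the derivatives of the
two coefficients and of τ contribute, and ∇τ is a multiple of `rotationalForm`. -/
theorem localCovDerivCurvature_eq [FiniteDimensional ℝ E] [FiniteDimensional ℝ V]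
    (h : IsRotationalPatch G F U c e J r) (hy : y ∈ U) (s u v w z : E) :
    localCovDerivCurvature G y s u v w z =
      deriv (coeffA r) ⟪e, F y - c⟫ * ⟪e, fderiv ℝ F y s⟫
        * (G y v w * G y u z - G y u w * G y v z) +
      deriv (axialCoeff r) ⟪e, F y - c⟫ * ⟪e, fderiv ℝ F y s⟫ *
        (G y v w * (⟪e, fderiv ℝ F y u⟫ * ⟪e, fderiv ℝ F y z⟫)
          - G y u w * (⟪e, fderiv ℝ F y v⟫ * ⟪e, fderiv ℝ F y z⟫)
          + G y u z * (⟪e, fderiv ℝ F y v⟫ * ⟪e, fderiv ℝ F y w⟫)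
          - G y v z * (⟪e, fderiv ℝ F y u⟫ * ⟪e, fderiv ℝ F y w⟫)) +
      axialCoeff r ⟪e, F y - c⟫ *
        (coeffA r ⟪e, F y - c⟫ * r ⟪e, F y - c⟫ * deriv r ⟪e, F y - c⟫) *
        (G y v w * (rotationalForm G F c e r y s u * ⟪e, fderiv ℝ F y z⟫
            + ⟪e, fderiv ℝ F y u⟫ * rotationalForm G F c e r y s z)
          - G y u w * (rotationalForm G F c e r y s v * ⟪e, fderiv ℝ F y z⟫
            + ⟪e, fderiv ℝ F y v⟫ * rotationalForm G F c e r y s z)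
          + G y u z * (rotationalForm G F c e r y s v * ⟪e, fderiv ℝ F y w⟫
            + ⟪e, fderiv ℝ F y v⟫ * rotationalForm G F c e r y s w)
          - G y v z * (rotationalForm G F c e r y s u * ⟪e, fderiv ℝ F y w⟫
            + ⟪e, fderiv ℝ F y u⟫ * rotationalForm G F c e r y s w)) := by
  have hJ := h.mem_param y hy
  have hA := h.hasFDerivAt_comp_param hy (hasDerivAt_coeffA h.isOpen_param h.radius_smooth hJ
    (h.radius_ne_zero _ hJ)).differentiableAt.hasDerivAt
  have hC := h.hasFDerivAt_comp_param hy (hasDerivAt_axialCoeff h.isOpen_param h.radius_smooth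
    h.radius_ne_zero hJ).differentiableAt.hasDerivAt
  have hG := fun u v => h.hasFDerivAt_metric_apply hy u v
  have hτ := fun u v => ((innerSL ℝ e).hasFDerivAt.comp y (h.hasFDerivAt_fderiv_apply hy u)).fun_mul
    ((innerSL ℝ e).hasFDerivAt.comp y (h.hasFDerivAt_fderiv_apply hy v))
  have h1 := (hA.fun_mul (((hG v w).fun_mul (hG u z)).fun_sub ((hG u w).fun_mul (hG v z)))).fun_add
    (hC.fun_mul (((((hG v w).fun_mul (hτ u z)).fun_sub ((hG u w).fun_mul (hτ v z))).fun_add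
      ((hG u z).fun_mul (hτ v w))).fun_sub ((hG v z).fun_mul (hτ u w))))
  have h2 : (fun x => localCurvature G x u v w z) =ᶠ[nhds y] _ :=
    (h.eventually_mem hy).mono fun x hx => h.localCurvature_eq_axial hx u v w z
  have h3 := (h1.congr_of_eventuallyEq h2).fderiv
  rw [localCovDerivCurvature, h3]
  simp only [h.localCurvature_eq_axial hy, add_apply, sub_apply, smul_apply, smul_eq_mul,
    ContinuousLinearMap.comp_apply, ContinuousLinearMap.flip_apply, innerSL_apply_apply,
    Function.comp_apply, h.fderiv_metric_eq_christoffel hy, h.inner_axis_fderiv_fderiv hy]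
  ring

/-- For s = αu + βv the ∇τ terms contribute 2(h(s, u)τ(u) + h(s, v)τ(v)) = 2τ(s)(1 - q(τ(u)² +
τ(v)²)), where h is `rotationalForm` and q = 1 + r'² + r r''. The 1 goes into `sectionalConst`, the
rest into `deriv_axialCoeff_sub`. -/
theorem localCovDerivCurvature_sectional [FiniteDimensional ℝ E] [FiniteDimensional ℝ V]
    (h : IsRotationalPatch G F U c e J r) (hy : y ∈ U) {u v : E} (hu : G y u u = 1)
    (hv : G y v v = 1) (huv : G y u v = 0) (α β : ℝ) :
    localCovDerivCurvature G y (α • u + β • v) u v v u =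
      (sectionalConst r ⟪e, F y - c⟫ - (1 + deriv r ⟪e, F y - c⟫ ^ 2) *
        deriv (fun s => coeffA r s - coeffB r s) ⟪e, F y - c⟫ *
        (⟪e, fderiv ℝ F y u⟫ ^ 2 + ⟪e, fderiv ℝ F y v⟫ ^ 2)) *
      ⟪e, fderiv ℝ F y (α • u + β • v)⟫ := by
  have hvu : G y v u = 0 := by rw [h.metric y hy, real_inner_comm, ← h.metric y hy, huv]
  have h1 := deriv_axialCoeff_sub h.isOpen_param h.radius_smooth h.radius_ne_zero (h.mem_param y hy)
  rw [sub_eq_add_neg, ← neg_mul, ← h1, h.localCovDerivCurvature_eq hy]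
  simp only [rotationalForm, map_add, map_smul, add_apply, smul_apply, smul_eq_mul, inner_add_right,
    real_inner_smul_right, hu, hv, huv, hvu, sectionalConst]
  ring

end IsRotationalPatch

end Patch

/-! ### Transfer from charts to the manifold. -/

section Manifold

variable {E : Type*} [NormedAddCommGroup E] [NormedSpace ℝ E]
  {H : Type*} [TopologicalSpace H] {I : ModelWithCorners ℝ E H}
  {M : Type*} [TopologicalSpace M] [ChartedSpace H M]

theorem ambientVector_add {n : ℕ} (f : M → EuclideanSpace ℝ (Fin (n + 1))) (p : M)
    (X Y : TangentSpace I p) :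
    ambientVector f p (X + Y) = ambientVector f p X + ambientVector f p Y :=
  map_add (mfderiv I 𝓘(ℝ, EuclideanSpace ℝ (Fin (n + 1))) f p) X Y

theorem ambientVector_smul {n : ℕ} (f : M → EuclideanSpace ℝ (Fin (n + 1))) (p : M)
    (a : ℝ) (X : TangentSpace I p) :
    ambientVector f p (a • X) = a • ambientVector f p X :=
  map_smul (mfderiv I 𝓘(ℝ, EuclideanSpace ℝ (Fin (n + 1))) f p) a X

theorem inChart_add (p : M) (X Y : TangentSpace I p) :
    inChart p (X + Y) = inChart p X + inChart p Y :=
  map_add (mfderiv I 𝓘(ℝ, E) (extChartAt I p) p) X Y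

theorem inChart_smul (p : M) (a : ℝ) (X : TangentSpace I p) :
    inChart p (a • X) = a • inChart p X :=
  map_smul (mfderiv I 𝓘(ℝ, E) (extChartAt I p) p) a X

variable [IsManifold I ∞ M]
  {g : Bundle.ContMDiffRiemannianMetric I ∞ E (fun x : M => TangentSpace I x)}
  {n : ℕ} {f : M → EuclideanSpace ℝ (Fin (n + 1))} {c e : EuclideanSpace ℝ (Fin (n + 1))}
  {J : Set ℝ} {r : ℝ → ℝ}

theorem mdifferentiableAt_extChartAt_symm [I.Boundaryless] (p : M) {y : E}
    (hy : y ∈ (extChartAt I p).target) :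
    MDifferentiableAt 𝓘(ℝ, E) I (extChartAt I p).symm y :=
  (((contMDiffOn_extChartAt_symm (I := I) (n := ∞) p).contMDiffAt
    ((isOpen_extChartAt_target p).mem_nhds hy))).mdifferentiableAt (by simp)

theorem injective_mfderiv_extChartAt_symm [I.Boundaryless] (p : M) {y : E}
    (hy : y ∈ (extChartAt I p).target) :
    Function.Injective (mfderiv 𝓘(ℝ, E) I (extChartAt I p).symm y) := by
  have : IsManifold I 1 M := .of_le (n := ∞) (by norm_cast)
  have h := isInvertible_mfderivWithin_extChartAt_symm (I := I) (x := p) hy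
  rw [I.range_eq_univ, mfderivWithin_univ] at h
  exact h.injective

namespace IsRotationalHypersurface

theorem mdifferentiableAt (h : IsRotationalHypersurface n g f c e J r) (p : M) :
    MDifferentiableAt I 𝓘(ℝ, EuclideanSpace ℝ (Fin (n + 1))) f p :=
  (h.smooth p).mdifferentiableAt (by simp)

theorem axialParameter_mem (h : IsRotationalHypersurface n g f c e J r) (p : M) :
    ⟪e, f p - c⟫ ∈ J ∧ ‖f p - c‖ ^ 2 = ⟪e, f p - c⟫ ^ 2 + r ⟪e, f p - c⟫ ^ 2 := by
  have h1 : f p ∈ Set.range f := ⟨p, rfl⟩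
  rw [h.range_eq] at h1
  obtain ⟨t, ht, h2, h3⟩ := h1
  have he : ⟪e, e⟫ = 1 := by rw [real_inner_self_eq_norm_sq, h.norm_axis, one_pow]
  rw [← sub_sub, inner_sub_right, real_inner_smul_right, he, mul_one, sub_eq_zero] at h3
  rw [← sub_sub, norm_sub_sq_real, norm_smul, h.norm_axis, real_inner_smul_right, real_inner_comm,
    h3, Real.norm_eq_abs, mul_one, sq_abs] at h2
  rw [h3]
  exact ⟨ht, by linarith⟩

theorem fderiv_comp_symm [I.Boundaryless] (h : IsRotationalHypersurface n g f c e J r) (p : M)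
    {y : E} (hy : y ∈ (extChartAt I p).target) (u : E) :
    fderiv ℝ (f ∘ (extChartAt I p).symm) y u = ambientVector f ((extChartAt I p).symm y)
      (mfderiv 𝓘(ℝ, E) I (extChartAt I p).symm y u) := by
  rw [← mfderiv_eq_fderiv, mfderiv_comp y (h.mdifferentiableAt _)
    (mdifferentiableAt_extChartAt_symm p hy)]
  rfl

theorem ambientVector_injective (h : IsRotationalHypersurface n g f c e J r) (p : M)
    {X : TangentSpace I p} (hX : ambientVector f p X = 0) : X = 0 := by
  by_contra h0
  have := g.pos p X h0
  rw [h.induced, hX, inner_zero_left] at this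
  exact lt_irrefl _ this

theorem isRotationalPatch [I.Boundaryless] (h : IsRotationalHypersurface n g f c e J r) (p : M) :
    IsRotationalPatch (metricInChart g p) (f ∘ (extChartAt I p).symm) (extChartAt I p).target
      c e J r where
  isOpen := isOpen_extChartAt_target p
  smooth := (h.smooth.comp_contMDiffOn (contMDiffOn_extChartAt_symm p)).contDiffOn
  metric y hy u v := by
    rw [h.fderiv_comp_symm p hy, h.fderiv_comp_symm p hy, ← h.induced]
    rfl
  injective y hy := by
    refine (injective_iff_map_eq_zero _).2 fun u hu => ?_
    rw [h.fderiv_comp_symm p hy] at hu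
    exact (injective_iff_map_eq_zero _).1 (injective_mfderiv_extChartAt_symm p hy) u
      (h.ambientVector_injective _ hu)
  finrank_ambient := by rw [h.finrank_eq, finrank_euclideanSpace_fin]
  isOpen_param := h.isOpen
  norm_axis := h.norm_axis
  radius_smooth := h.radius_smooth
  radius_pos := h.radius_pos
  mem_param y _ := (h.axialParameter_mem _).1
  norm_sq y _ := (h.axialParameter_mem _).2

theorem fderiv_inChart [I.Boundaryless] (h : IsRotationalHypersurface n g f c e J r) (p : M)
    (X : TangentSpace I p) :
    fderiv ℝ (f ∘ (extChartAt I p).symm) (extChartAt I p p) (inChart p X) =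
      ambientVector f p X := by
  have hd : MDifferentiableAt 𝓘(ℝ, E) 𝓘(ℝ, EuclideanSpace ℝ (Fin (n + 1)))
      (f ∘ (extChartAt I p).symm) (extChartAt I p p) :=
    (((h.isRotationalPatch p).contDiffAt (mem_extChartAt_target p)).differentiableAt
      (by simp)).mdifferentiableAt
  have hφ : MDifferentiableAt I 𝓘(ℝ, E) (extChartAt I p) p :=
    (contMDiffAt_extChartAt (n := ∞)).mdifferentiableAt (by simp)
  have h1 : f =ᶠ[nhds p] (f ∘ (extChartAt I p).symm) ∘ extChartAt I p := by
    filter_upwards [extChartAt_source_mem_nhds (I := I) p] with x hx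
    rw [Function.comp_apply, Function.comp_apply, (extChartAt I p).left_inv hx]
  rw [ambientVector, h1.mfderiv_eq, mfderiv_comp p hd hφ, mfderiv_eq_fderiv]
  rfl

theorem metricInChart_inChart [I.Boundaryless] (h : IsRotationalHypersurface n g f c e J r) (p : M)
    (X Y : TangentSpace I p) :
    metricInChart g p (extChartAt I p p) (inChart p X) (inChart p Y) = g.inner p X Y := by
  rw [(h.isRotationalPatch p).metric _ (mem_extChartAt_target p), h.fderiv_inChart,
    h.fderiv_inChart, h.induced]

theorem exists_ambientVector_eq [I.Boundaryless] [FiniteDimensional ℝ E]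
    (h : IsRotationalHypersurface n g f c e J r) (p : M) {w : EuclideanSpace ℝ (Fin (n + 1))}
    (hw : ⟪rotationalNormal c e r (f p), w⟫ = 0) :
    ∃ X : TangentSpace I p, ambientVector f p X = w := by
  have h1 := (h.isRotationalPatch p).exists_fderiv_eq (mem_extChartAt_target p) (w := w) (by simpa)
  obtain ⟨u, hu⟩ := h1
  rw [h.fderiv_comp_symm p (mem_extChartAt_target p)] at hu
  have h2 := (extChartAt I p).left_inv (mem_extChartAt_source p)
  -- The vector is tangent at φ⁻¹(φ p), which equals p only propositionally; generalizing vector and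
  -- base point allows the substitution.
  generalize mfderiv 𝓘(ℝ, E) I (extChartAt I p).symm (extChartAt I p p) u = X at hu
  generalize (extChartAt I p).symm (extChartAt I p p) = q at h2 X
  subst h2
  exact ⟨X, hu⟩

theorem inner_rotationalNormal_ambientVector [I.Boundaryless]
    (h : IsRotationalHypersurface n g f c e J r) (p : M) (X : TangentSpace I p) :
    ⟪rotationalNormal c e r (f p), ambientVector f p X⟫ = 0 := by
  have := (h.isRotationalPatch p).inner_rotationalNormal_fderiv (mem_extChartAt_target p)
    (inChart p X)
  rw [h.fderiv_inChart] at this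
  simpa using this

theorem curvatureTensor_eq [I.Boundaryless] [FiniteDimensional ℝ E]
    (h : IsRotationalHypersurface n g f c e J r) (p : M) (X Y Z U : TangentSpace I p) :
    curvatureTensor g p X Y Z U =
      coeffA r ⟪e, f p - c⟫ * piTensor g p X Y Z U +
      axialCoeff r ⟪e, f p - c⟫ *
        (g.inner p Y Z * (⟪e, ambientVector f p X⟫ * ⟪e, ambientVector f p U⟫)
          - g.inner p X Z * (⟪e, ambientVector f p Y⟫ * ⟪e, ambientVector f p U⟫)
          + g.inner p X U * (⟪e, ambientVector f p Y⟫ * ⟪e, ambientVector f p Z⟫)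
          - g.inner p Y U * (⟪e, ambientVector f p X⟫ * ⟪e, ambientVector f p Z⟫)) := by
  rw [curvatureTensor, (h.isRotationalPatch p).localCurvature_eq_axial (mem_extChartAt_target p)]
  simp only [h.fderiv_inChart, h.metricInChart_inChart, Function.comp_apply,
    extChartAt_to_inv, piTensor]

theorem sectionalForm_eq [I.Boundaryless] [FiniteDimensional ℝ E]
    (h : IsRotationalHypersurface n g f c e J r) (p : M) {X Y : TangentSpace I p}
    (hX : g.inner p X X = 1) (hY : g.inner p Y Y = 1) (hXY : g.inner p X Y = 0)
    {Z : TangentSpace I p} (hZ : Z ∈ Submodule.span ℝ {X, Y}) :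
    sectionalForm g p X Y Z =
      (sectionalConst r ⟪e, f p - c⟫ - (1 + deriv r ⟪e, f p - c⟫ ^ 2) *
        deriv (fun s => coeffA r s - coeffB r s) ⟪e, f p - c⟫ *
        (⟪e, ambientVector f p X⟫ ^ 2 + ⟪e, ambientVector f p Y⟫ ^ 2)) *
      ⟪e, ambientVector f p Z⟫ := by
  obtain ⟨α, β, rfl⟩ := Submodule.mem_span_pair.1 hZ
  rw [sectionalForm, covDerivCurvature, inChart_add, inChart_smul, inChart_smul,
    (h.isRotationalPatch p).localCovDerivCurvature_sectional (mem_extChartAt_target p),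
    ← inChart_smul, ← inChart_smul, ← inChart_add]
  · simp only [h.fderiv_inChart, Function.comp_apply, extChartAt_to_inv]
  all_goals rwa [h.metricInChart_inChart]

end IsRotationalHypersurface

end Manifold

/-! ### The meridian 1-form and the two directions of the criterion. -/

section Meridian

/-- Two given vectors of a space of dimension at least four have a common orthonormal pair in their
orthogonal complement. -/
theorem exists_orthonormal_pair_orthogonal {V : Type*} [NormedAddCommGroup V]
    [InnerProductSpace ℝ V] [FiniteDimensional ℝ V] (hV : 4 ≤ Module.finrank ℝ V) (a b : V) :
    ∃ v w : V, ⟪v, v⟫ = 1 ∧ ⟪w, w⟫ = 1 ∧ ⟪v, w⟫ = 0 ∧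
      ⟪a, v⟫ = 0 ∧ ⟪a, w⟫ = 0 ∧ ⟪b, v⟫ = 0 ∧ ⟪b, w⟫ = 0 := by
  classical
  set S := Submodule.span ℝ {a, b}
  have h1 : Module.finrank ℝ S ≤ 2 := by
    refine (finrank_span_le_card ({a, b} : Set V)).trans ?_
    simpa using Finset.card_le_two (a := a) (b := b)
  have h2 := S.finrank_add_finrank_orthogonal
  let B := stdOrthonormalBasis ℝ Sᗮ
  have hB := orthonormal_iff_ite.1 B.orthonormal
  let i : Fin (Module.finrank ℝ Sᗮ) := ⟨0, by omega⟩
  let j : Fin (Module.finrank ℝ Sᗮ) := ⟨1, by omega⟩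
  have hij : i ≠ j := by simp [i, j]
  have ha : a ∈ S := Submodule.subset_span (by simp)
  have hb : b ∈ S := Submodule.subset_span (by simp)
  refine ⟨B i, B j, ?_, ?_, ?_, (B i).2 a ha, (B j).2 a ha, (B i).2 b hb, (B j).2 b hb⟩
  · exact (hB i i).trans (if_pos rfl)
  · exact (hB j j).trans (if_pos rfl)
  · exact (hB i j).trans (if_neg hij)

variable {E : Type*} [NormedAddCommGroup E] [NormedSpace ℝ E]
  {H : Type*} [TopologicalSpace H] {I : ModelWithCorners ℝ E H}
  {M : Type*} [TopologicalSpace M] [ChartedSpace H M]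

/-- The 1-form dual to the unit tangent vector of the meridians pointing in direction `e`. -/
noncomputable def meridianForm {n : ℕ} (f : M → EuclideanSpace ℝ (Fin (n + 1)))
    (c e : EuclideanSpace ℝ (Fin (n + 1))) (r : ℝ → ℝ) (p : M) : TangentSpace I p →L[ℝ] ℝ :=
  √(1 + deriv r ⟪e, f p - c⟫ ^ 2) • (innerSL ℝ e ∘L
    (mfderiv I 𝓘(ℝ, EuclideanSpace ℝ (Fin (n + 1))) f p :
      TangentSpace I p →L[ℝ] EuclideanSpace ℝ (Fin (n + 1))))

theorem meridianForm_apply {n : ℕ} (f : M → EuclideanSpace ℝ (Fin (n + 1)))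
    (c e : EuclideanSpace ℝ (Fin (n + 1))) (r : ℝ → ℝ) (p : M) (X : TangentSpace I p) :
    meridianForm f c e r p X = √(1 + deriv r ⟪e, f p - c⟫ ^ 2) * ⟪e, ambientVector f p X⟫ :=
  rfl

variable [IsManifold I ∞ M]
  {g : Bundle.ContMDiffRiemannianMetric I ∞ E (fun x : M => TangentSpace I x)}
  {n : ℕ} {f : M → EuclideanSpace ℝ (Fin (n + 1))} {c e : EuclideanSpace ℝ (Fin (n + 1))}
  {J : Set ℝ} {r : ℝ → ℝ}

theorem finrank_span_pair_of_orthonormal (p : M) {X Y : TangentSpace I p}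
    (hX : g.inner p X X = 1) (hY : g.inner p Y Y = 1) (hXY : g.inner p X Y = 0) :
    Module.finrank ℝ (Submodule.span ℝ {X, Y}) = 2 := by
  have h1 : LinearIndependent ℝ ![X, Y] := by
    refine LinearIndependent.pair_iff.2 fun a b hab => ?_
    have h2 := congrArg (g.inner p X) hab
    have h3 := congrArg (fun Z => g.inner p Z Y) hab
    simp [hX, hXY] at h2
    simp [hY, hXY] at h3
    exact ⟨h2, h3⟩
  have h2 := finrank_span_eq_card h1
  rwa [Matrix.range_cons_cons_empty, Fintype.card_fin] at h2

theorem contMDiff_meridianForm (h : IsRotationalHypersurface n g f c e J r) :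
    ContMDiff I (I.prod 𝓘(ℝ, E →L[ℝ] ℝ)) ∞
      (fun p => Bundle.TotalSpace.mk' (E →L[ℝ] ℝ)
        (E := fun x : M => TangentSpace I x →L[ℝ] Bundle.Trivial M ℝ x) p
        (meridianForm f c e r p)) := by
  intro p
  refine (contMDiffAt_hom_bundle _).2 ⟨contMDiffAt_id, ?_⟩
  have h1 : ContMDiffAt I 𝓘(ℝ, ℝ) ∞ (fun q => √(1 + deriv r ⟪e, f q - c⟫ ^ 2)) p := by
    have h2 : ContDiffAt ℝ ∞ (fun x : EuclideanSpace ℝ (Fin (n + 1)) => ⟪e, x - c⟫) (f p) :=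
      contDiffAt_const.inner ℝ (contDiffAt_id.sub contDiffAt_const)
    have h3 : ContDiffAt ℝ ∞ (deriv r) ⟪e, f p - c⟫ :=
      (contDiffOn_deriv_of_isOpen h.isOpen h.radius_smooth).contDiffAt
        (h.isOpen.mem_nhds (h.axialParameter_mem p).1)
    have h4 := (contDiffAt_const (c := (1 : ℝ)).add ((h3.comp (f p) h2).pow 2)).sqrt
      (by positivity)
    exact h4.contMDiffAt.comp p (h.smooth p)
  have h2 := (h.smooth p).mfderiv_const (m := ∞) (by simp)
  have h3 : ContMDiffAt I 𝓘(ℝ, E →L[ℝ] ℝ) ∞ (fun q => √(1 + deriv r ⟪e, f q - c⟫ ^ 2) •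
      (innerSL ℝ e ∘L inTangentCoordinates I 𝓘(ℝ, EuclideanSpace ℝ (Fin (n + 1))) id f
        (mfderiv I 𝓘(ℝ, EuclideanSpace ℝ (Fin (n + 1))) f) p q)) p :=
    h1.smul (contMDiffAt_const.clm_comp h2)
  refine h3.congr_of_eventuallyEq (Filter.Eventually.of_forall fun q => ?_)
  ext v
  simp [ContinuousLinearMap.inCoordinates, inTangentCoordinates, meridianForm]
  exact Or.inl rfl

namespace IsRotationalHypersurface

theorem exists_unit_dual_meridianForm [I.Boundaryless] [FiniteDimensional ℝ E]
    (h : IsRotationalHypersurface n g f c e J r) (p : M) :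
    ∃ ξ : TangentSpace I p, g.inner p ξ ξ = 1 ∧ ∀ X, meridianForm f c e r p X = g.inner p ξ X := by
  obtain ⟨hJ, hx⟩ := h.axialParameter_mem p
  have hr := h.radius_pos _ hJ
  have hs := inner_rotationalNormal_self h.norm_axis hx
  have hi := inner_axis_rotationalNormal (c := c) (r := r) (f p) h.norm_axis
  set ν := rotationalNormal c e r (f p)
  set ρ := r ⟪e, f p - c⟫
  set ρ' := deriv r ⟪e, f p - c⟫ with hρ'
  have hp : 0 < 1 + ρ' ^ 2 := by positivity
  have he : ⟪e, e⟫ = 1 := by rw [real_inner_self_eq_norm_sq, h.norm_axis, one_pow]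
  -- This is e - (⟨e, ν⟩/|ν|²)ν, the tangential projection of the axis. Its squared norm is 1/(1 +
  -- r'²), whence the normalizing square root below.
  have hw : ⟪ν, e + (ρ' / (ρ * (1 + ρ' ^ 2))) • ν⟫ = 0 := by
    rw [inner_add_right, real_inner_smul_right, real_inner_comm, hi, hs]
    field_simp
    ring
  have hw' : ⟪ν, √(1 + ρ' ^ 2) • (e + (ρ' / (ρ * (1 + ρ' ^ 2))) • ν)⟫ = 0 := by
    rw [real_inner_smul_right, hw, mul_zero]
  obtain ⟨ξ, hξ⟩ := h.exists_ambientVector_eq p hw'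
  have hd (X : TangentSpace I p) : meridianForm f c e r p X = g.inner p ξ X := by
    rw [h.induced, hξ, real_inner_smul_left, inner_add_left, real_inner_smul_left,
      h.inner_rotationalNormal_ambientVector, mul_zero, add_zero, meridianForm_apply]
  refine ⟨ξ, ?_, hd⟩
  rw [← hd, meridianForm_apply, hξ, real_inner_smul_right, inner_add_right, real_inner_smul_right,
    hi, he, ← mul_assoc, ← hρ', Real.mul_self_sqrt hp.le]
  field_simp
  ring

theorem isUnitOneForm_meridianForm [I.Boundaryless] [FiniteDimensional ℝ E]
    (h : IsRotationalHypersurface n g f c e J r) : IsUnitOneForm g (meridianForm f c e r) :=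
  ⟨contMDiff_meridianForm h, h.exists_unit_dual_meridianForm⟩

/-- The products of the components of the form dual to a meridian unit vector do not depend on the
sign of this vector. -/
theorem inner_meridian_mul [I.Boundaryless] [FiniteDimensional ℝ E]
    (h : IsRotationalHypersurface n g f c e J r) {p : M} {ξ : TangentSpace I p}
    (hξ : IsMeridianUnitVector g f e p ξ) (X Y : TangentSpace I p) :
    g.inner p ξ X * g.inner p ξ Y = (1 + deriv r ⟪e, f p - c⟫ ^ 2) *
      (⟪e, ambientVector f p X⟫ * ⟪e, ambientVector f p Y⟫) := by
  obtain ⟨ζ, hζ, hd⟩ := h.exists_unit_dual_meridianForm p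
  have hp : 0 < 1 + deriv r ⟪e, f p - c⟫ ^ 2 := by positivity
  have hsq := Real.mul_self_sqrt hp.le
  -- Removing the ζ-component of Z leaves a vector tangent to the parallel, to which ξ is
  -- orthogonal. So ξ is a multiple of ζ, and both being unit vectors the factor squares to 1.
  have key (Z : TangentSpace I p) : g.inner p ξ Z = g.inner p ζ Z * g.inner p ξ ζ := by
    have h1 : ⟪e, ambientVector f p (Z + (-g.inner p ζ Z) • ζ)⟫ = 0 := by
      have h2 := hd (Z + (-g.inner p ζ Z) • ζ)
      rw [meridianForm_apply, map_add, map_smul, hζ, smul_eq_mul, mul_one, add_neg_cancel] at h2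
      exact (mul_eq_zero.1 h2).resolve_left (Real.sqrt_pos.2 hp).ne'
    have h3 := hξ.perp _ h1
    rw [map_add, map_smul, smul_eq_mul] at h3
    linarith
  have h1 : g.inner p ξ ζ * g.inner p ξ ζ = 1 := by
    rw [← hξ.unit, key ξ, g.symm p ζ ξ]
  rw [key X, key Y, ← hd, ← hd, meridianForm_apply, meridianForm_apply]
  linear_combination (⟪e, ambientVector f p X⟫ * ⟪e, ambientVector f p Y⟫) *
    (√(1 + deriv r ⟪e, f p - c⟫ ^ 2) * √(1 + deriv r ⟪e, f p - c⟫ ^ 2) * h1 + hsq)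

theorem curvatureTensor_eq_of_isMeridianUnitVector [I.Boundaryless] [FiniteDimensional ℝ E]
    (h : IsRotationalHypersurface n g f c e J r) {p : M} {ξ : TangentSpace I p}
    (hξ : IsMeridianUnitVector g f e p ξ) (X Y Z U : TangentSpace I p) :
    curvatureTensor g p X Y Z U =
      coeffA r (axialParameter c e (f p)) * piTensor g p X Y Z U +
      coeffB r (axialParameter c e (f p)) * phiTensor g p (g.inner p ξ) X Y Z U := by
  have hm := h.inner_meridian_mul hξ
  rw [h.curvatureTensor_eq, axialCoeff, phiTensor, axialParameter]
  simp only [mul_assoc, hm]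
  ring

theorem exists_point (hn : 3 ≤ n) (h : IsRotationalHypersurface n g f c e J r) {t : ℝ}
    (ht : t ∈ J) : ∃ p : M, ⟪e, f p - c⟫ = t := by
  obtain ⟨v, -, hv, -, -, hev, -⟩ := exists_orthonormal_pair_orthogonal (by simp; omega) e e
  have h1 : c + t • e + r t • v ∈ Set.range f := by
    rw [h.range_eq]
    refine ⟨t, ht, ?_, ?_⟩
    · rw [real_inner_self_eq_norm_sq] at hv
      rw [add_sub_cancel_left, norm_smul, mul_pow, hv, mul_one, Real.norm_eq_abs, sq_abs]
    · rw [add_sub_cancel_left, real_inner_smul_right, hev, mul_zero]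
  obtain ⟨p, hp⟩ := h1
  refine ⟨p, ?_⟩
  rw [hp, add_assoc, add_sub_cancel_left, inner_add_right, real_inner_smul_right,
    real_inner_smul_right, hev, real_inner_self_eq_norm_sq, h.norm_axis]
  ring

theorem exists_orthonormal_parallel_pair [I.Boundaryless] [FiniteDimensional ℝ E] (hn : 3 ≤ n)
    (h : IsRotationalHypersurface n g f c e J r) (p : M) :
    ∃ X Y : TangentSpace I p, g.inner p X X = 1 ∧ g.inner p Y Y = 1 ∧ g.inner p X Y = 0 ∧
      ⟪e, ambientVector f p X⟫ = 0 ∧ ⟪e, ambientVector f p Y⟫ = 0 := by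
  obtain ⟨v, w, hv, hw, hvw, hev, hew, hnv, hnw⟩ :=
    exists_orthonormal_pair_orthogonal (by simp; omega) e (rotationalNormal c e r (f p))
  obtain ⟨X, hX⟩ := h.exists_ambientVector_eq p hnv
  obtain ⟨Y, hY⟩ := h.exists_ambientVector_eq p hnw
  refine ⟨X, Y, ?_, ?_, ?_, ?_, ?_⟩ <;> simp only [h.induced, hX, hY, hv, hw, hvw, hev, hew]

theorem hasPointwiseConstant_of_deriv_eq_zero [I.Boundaryless] [FiniteDimensional ℝ E]
    (h : IsRotationalHypersurface n g f c e J r)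
    (hD : ∀ t ∈ J, deriv (fun s => coeffA r s - coeffB r s) t = 0) :
    HasPointwiseConstantRelativeSectionalCurvature g := by
  refine ⟨meridianForm f c e r, h.isUnitOneForm_meridianForm,
    fun p _ => sectionalConst r ⟪e, f p - c⟫ / √(1 + deriv r ⟪e, f p - c⟫ ^ 2), ?_,
    fun _ _ _ _ _ _ _ => rfl⟩
  rintro p P X Y ⟨hX, hY, hXY, rfl⟩
  have hp : √(1 + deriv r ⟪e, f p - c⟫ ^ 2) ≠ 0 := (Real.sqrt_pos.2 (by positivity)).ne'
  have key : ∀ Z ∈ Submodule.span ℝ {X, Y}, sectionalForm g p X Y Z =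
      sectionalConst r ⟪e, f p - c⟫ / √(1 + deriv r ⟪e, f p - c⟫ ^ 2) *
        meridianForm f c e r p Z := fun Z hZ => by
    rw [h.sectionalForm_eq p hX hY hXY hZ, hD _ (h.axialParameter_mem p).1, meridianForm_apply]
    field_simp
    ring
  exact ⟨fun _ => key, fun h0 Z hZ => by rw [key Z hZ, h0 Z hZ, mul_zero]⟩

/-- The directing form need not be identified with the meridian form: its linearity and its values
on three planes suffice. -/
theorem deriv_eq_zero_of_hasPointwiseConstant [I.Boundaryless] [FiniteDimensional ℝ E] (hn : 3 ≤ n)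
    (h : IsRotationalHypersurface n g f c e J r)
    (hk : HasPointwiseConstantRelativeSectionalCurvature g) {t : ℝ} (ht : t ∈ J) :
    deriv (fun s => coeffA r s - coeffB r s) t = 0 := by
  obtain ⟨η, -, k, hk, hconst⟩ := hk
  obtain ⟨p, rfl⟩ := h.exists_point hn ht
  -- One K covers both clauses of the definition, since on a plane inside the kernel of η both sides
  -- vanish. If every plane lies in the kernel, K = 0 works.
  have h1 : ∃ K : ℝ, ∀ X Y : TangentSpace I p, g.inner p X X = 1 → g.inner p Y Y = 1 →
      g.inner p X Y = 0 → ∀ Z ∈ Submodule.span ℝ {X, Y}, sectionalForm g p X Y Z = K * η p Z := by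
    by_cases h0 : ∃ P : Submodule ℝ (TangentSpace I p),
        Module.finrank ℝ P = 2 ∧ ¬ ∀ Z ∈ P, η p Z = 0
    · obtain ⟨P, hP, hPη⟩ := h0
      refine ⟨k p P, fun X Y hX hY hXY Z hZ => ?_⟩
      have h2 := hk p _ X Y ⟨hX, hY, hXY, rfl⟩
      by_cases h3 : ∀ Z ∈ Submodule.span ℝ {X, Y}, η p Z = 0
      · rw [h2.2 h3 Z hZ, h3 Z hZ, mul_zero]
      · rw [h2.1 h3 Z hZ,
          hconst p _ P (finrank_span_pair_of_orthonormal p hX hY hXY) hP h3 hPη]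
    · push Not at h0
      refine ⟨0, fun X Y hX hY hXY Z hZ => ?_⟩
      rw [zero_mul]
      exact (hk p _ X Y ⟨hX, hY, hXY, rfl⟩).2
        (h0 _ (finrank_span_pair_of_orthonormal p hX hY hXY)) Z hZ
  obtain ⟨K, hK⟩ := h1
  obtain ⟨ξ, hξ, hd⟩ := h.exists_unit_dual_meridianForm p
  obtain ⟨X, Y, hX, hY, hXY, hτX, hτY⟩ := h.exists_orthonormal_parallel_pair hn p
  have hp : 0 < 1 + deriv r ⟪e, f p - c⟫ ^ 2 := by positivity
  have hξX : g.inner p ξ X = 0 := by rw [← hd, meridianForm_apply, hτX, mul_zero]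
  have hξY : g.inner p ξ Y = 0 := by rw [← hd, meridianForm_apply, hτY, mul_zero]
  have hτξ : ⟪e, ambientVector f p ξ⟫ ≠ 0 := fun h0 => by
    have h2 := hd ξ
    rw [meridianForm_apply, h0, mul_zero, hξ] at h2
    exact zero_ne_one h2
  have hs : (√2)⁻¹ * (√2)⁻¹ = (1 / 2 : ℝ) := by
    rw [← mul_inv, Real.mul_self_sqrt zero_le_two, one_div]
  have hs0 : (√2)⁻¹ ≠ (0 : ℝ) := by positivity
  set s : ℝ := (√2)⁻¹
  have e0 := hK X Y hX hY hXY X (Submodule.subset_span (by simp))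
  have e1 := hK ξ X hξ hX hξX ξ (Submodule.subset_span (by simp))
  have hW : g.inner p (s • (ξ + X)) (s • (ξ + X)) = 1 := by
    simp only [map_smul, map_add, add_apply, smul_apply, smul_eq_mul, hξ, hX, hξX,
      g.symm p X ξ]
    linear_combination 2 * hs
  have hWY : g.inner p (s • (ξ + X)) Y = 0 := by
    simp only [map_smul, map_add, add_apply, smul_apply, smul_eq_mul, hξY, hXY]
    ring
  have e2 := hK (s • (ξ + X)) Y hW hY hWY _ (Submodule.subset_span (Set.mem_insert _ _))
  rw [h.sectionalForm_eq p hX hY hXY (Submodule.subset_span (by simp)), hτX] at e0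
  rw [h.sectionalForm_eq p hξ hX hξX (Submodule.subset_span (by simp)), hτX] at e1
  rw [h.sectionalForm_eq p hW hY hWY (Submodule.subset_span (Set.mem_insert _ _)), hτY,
    ambientVector_smul, ambientVector_add, real_inner_smul_right, inner_add_right, hτX,
    map_smul, map_add, smul_eq_mul] at e2
  generalize ⟪e, ambientVector f p ξ⟫ = τ at *
  generalize deriv (fun s => coeffA r s - coeffB r s) ⟪e, f p - c⟫ = D at *
  have e3 : s * ((1 + deriv r ⟪e, f p - c⟫ ^ 2) * D * τ ^ 3 * (1 / 2)) = 0 := by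
    linear_combination s * (1 + deriv r ⟪e, f p - c⟫ ^ 2) * D * τ ^ 3 * hs - s * e1 - s * e0 + e2
  simpa [hs0, hp.ne', hτξ] using e3

end IsRotationalHypersurface

end Meridian

theorem proposition3p2 {n : ℕ} (hn : 3 ≤ n)
    {E : Type*} [NormedAddCommGroup E] [NormedSpace ℝ E]
    {H : Type*} [TopologicalSpace H] (I : ModelWithCorners ℝ E H) [I.Boundaryless]
    {M : Type*} [TopologicalSpace M] [ChartedSpace H M] [IsManifold I ∞ M]
    (g : Bundle.ContMDiffRiemannianMetric I ∞ E (fun x : M => TangentSpace I x))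
    (f : M → EuclideanSpace ℝ (Fin (n + 1))) (c e : EuclideanSpace ℝ (Fin (n + 1)))
    (J : Set ℝ) (r : ℝ → ℝ) (hM : IsRotationalHypersurface n g f c e J r) :
    (∀ (p : M) (ξ : TangentSpace I p), IsMeridianUnitVector g f e p ξ →
      ∀ X Y Z U : TangentSpace I p, curvatureTensor g p X Y Z U =
        coeffA r (axialParameter c e (f p)) * piTensor g p X Y Z U +
        coeffB r (axialParameter c e (f p)) * phiTensor g p (g.inner p ξ) X Y Z U) ∧
    (HasPointwiseConstantRelativeSectionalCurvature g ↔
      ∃ B : ℝ, ∀ t ∈ J, coeffA r t - coeffB r t = B) := by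
  -- A positive `finrank` excludes the default value 0 of infinite dimension.
  have : FiniteDimensional ℝ E := .of_finrank_pos (by rw [hM.finrank_eq]; omega)
  refine ⟨fun p ξ hξ => hM.curvatureTensor_eq_of_isMeridianUnitVector hξ, fun hk => ?_, ?_⟩
  · have h0 : ∀ t ∈ J, r t ≠ 0 := fun t ht => (hM.radius_pos t ht).ne'
    refine hM.isOpen.exists_is_const_of_deriv_eq_zero hM.ordConnected.isPreconnected
      (fun t ht => ?_) fun t ht => hM.deriv_eq_zero_of_hasPointwiseConstant hn hk ht
    exact ((hasDerivAt_coeffA hM.isOpen hM.radius_smooth ht (h0 t ht)).differentiableAt.fun_sub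
      ((contDiffOn_coeffB hM.isOpen hM.radius_smooth h0).hasDerivAt_of_isOpen hM.isOpen
        ht).differentiableAt).differentiableWithinAt
  · rintro ⟨B, hB⟩
    refine hM.hasPointwiseConstant_of_deriv_eq_zero fun t ht => ?_
    have h1 : (fun s => coeffA r s - coeffB r s) =ᶠ[nhds t] fun _ => B :=
      Filter.mem_of_superset (hM.isOpen.mem_nhds ht) hB
    rw [h1.deriv_eq, deriv_const]
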